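/- Let $\tau\in\mathbb{C}$ with $\operatorname{Im}\tau>0$, let $q=e^{2\pi i\tau}$, and for $r\in\mathbb{R}$ write $q^{r}=e^{2\pi i r\tau}$. A function $f(q)$ of $q$ is understood as a function of $\tau$, so that $f(q^{r})$, for $r>0$, denotes $f$ with $\tau$ replaced by $r\tau$. Define $$\theta_3(q)=\sum_{n\in\mathbb{Z}}q^{n^2},\qquad \theta_4(q)=\sum_{n\in\mathbb{Z}}(-1)^nq^{n^2},$$ and the Borweins' cubic theta functions $$a(q)=\sum_{m,n\in\mathbb{Z}}q^{n^2+nm+m^2},\qquad c(q)=\sum_{m,n\in\mathbb{Z}}q^{(n+\frac13)^2+(n+\frac13)(m+\frac13)+(m+\frac13)^2}.$$ Then $$a(q)a(q^2)+2c(q)c(q^2)=\tfrac12\bigl(\theta_3(q^{1/2})^4+\theta_4(q^{1/2})^4\bigr).$$ -/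

import Mathlib

noncomputable section

namespace CubicTheta

/-- The power `q ^ r` of the nome `q = exp (2 π i τ)`, for a real exponent `r`,
with the branch `q ^ r = exp (2 π i r τ)`. A function `f(q)` is written below as a
function of `τ`; then `f(q ^ k)` is its value at `k * τ`. -/
def qPow (τ : ℂ) (r : ℝ) : ℂ :=
  Complex.exp (2 * Real.pi * Complex.I * r * τ)

/-- The Jacobi theta function `θ₃(q) = ϑ(0; 2τ)`, where
`ϑ(z; t) = ∑ n : ℤ, exp (π i n² t + 2 π i n z)`. -/
def theta3 (τ : ℂ) : ℂ := jacobiTheta₂ 0 (2 * τ)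

/-- The Jacobi theta function `θ₄(q) = ϑ(1/2; 2τ)`. -/
def theta4 (τ : ℂ) : ℂ := jacobiTheta₂ (1 / 2) (2 * τ)

/-- The Borweins' cubic theta function
`a(q) = ∑ m n : ℤ, q ^ (n² + n m + m²)`. -/
def cubicA (τ : ℂ) : ℂ :=
  ∑' p : ℤ × ℤ, qPow τ ((p.2 : ℝ) ^ 2 + p.2 * p.1 + (p.1 : ℝ) ^ 2)

/-- The Borweins' cubic theta function
`c(q) = ∑ m n : ℤ, q ^ ((n + 1/3)² + (n + 1/3)(m + 1/3) + (m + 1/3)²)`. -/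
def cubicC (τ : ℂ) : ℂ :=
  ∑' p : ℤ × ℤ, qPow τ
    (((p.2 : ℝ) + 1 / 3) ^ 2 + ((p.2 : ℝ) + 1 / 3) * ((p.1 : ℝ) + 1 / 3)
      + ((p.1 : ℝ) + 1 / 3) ^ 2)

/-- The series `θ₃(q) = ∑ n : ℤ, q ^ (n²)`. -/
theorem hasSum_theta3 {τ : ℂ} (hτ : 0 < τ.im) :
    HasSum (fun n : ℤ => qPow τ ((n : ℝ) ^ 2)) (theta3 τ) := by
  have h := hasSum_jacobiTheta₂_term 0 (τ := 2 * τ) (by simpa using hτ)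
  rw [theta3]
  convert h using 2 with n
  rw [qPow, jacobiTheta₂_term]
  congr 1
  push_cast
  ring

/-- The series `θ₄(q) = ∑ n : ℤ, (-1) ^ n q ^ (n²)`. -/
theorem hasSum_theta4 {τ : ℂ} (hτ : 0 < τ.im) :
    HasSum (fun n : ℤ => (-1 : ℂ) ^ n * qPow τ ((n : ℝ) ^ 2)) (theta4 τ) := by
  have h := hasSum_jacobiTheta₂_term (1 / 2) (τ := 2 * τ) (by simpa using hτ)
  rw [theta4]
  convert h using 2 with n
  have h1 : (-1 : ℂ) ^ n = Complex.exp (n * (Real.pi * Complex.I)) := by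
    rw [Complex.exp_int_mul, Complex.exp_pi_mul_I]
  rw [qPow, jacobiTheta₂_term, h1, ← Complex.exp_add]
  congr 1
  push_cast
  ring

theorem summable_shifted {τ : ℂ} (hτ : 0 < τ.im) (s : ℝ) :
    Summable (fun p : ℤ × ℤ => qPow τ
      (((p.2 : ℝ) + s) ^ 2 + ((p.2 : ℝ) + s) * ((p.1 : ℝ) + s) + ((p.1 : ℝ) + s) ^ 2)) := by
  have h1 : Summable (fun n : ℤ => Real.exp (-Real.pi * τ.im * ((n : ℝ) + s) ^ 2)) := by
    have h := ((hasSum_jacobiTheta₂_term (Complex.I * (τ.im * s : ℝ))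
      (τ := Complex.I * (τ.im : ℝ)) (by simpa using hτ)).summable.norm).mul_left
      (Real.exp (-Real.pi * τ.im * s ^ 2))
    refine h.congr fun n => ?_
    rw [norm_jacobiTheta₂_term, ← Real.exp_add]
    congr 1
    simp
    ring
  have h2 := h1.mul_of_nonneg h1 (fun _ => (Real.exp_pos _).le) (fun _ => (Real.exp_pos _).le)
  refine Summable.of_norm_bounded h2 fun p => ?_
  rw [qPow, Complex.norm_exp, ← Real.exp_add, Real.exp_le_exp]
  have hre : (2 * Real.pi * Complex.I *
      (((((p.2 : ℝ) + s) ^ 2 + ((p.2 : ℝ) + s) * ((p.1 : ℝ) + s) + ((p.1 : ℝ) + s) ^ 2 : ℝ)) : ℂ)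
        * τ).re = -(2 * Real.pi * τ.im *
      (((p.2 : ℝ) + s) ^ 2 + ((p.2 : ℝ) + s) * ((p.1 : ℝ) + s) + ((p.1 : ℝ) + s) ^ 2)) := by
    generalize (((p.2 : ℝ) + s) ^ 2 + ((p.2 : ℝ) + s) * ((p.1 : ℝ) + s) + ((p.1 : ℝ) + s) ^ 2) = r
    simp
    ring
  rw [hre]
  have hc : 0 ≤ Real.pi * τ.im := by positivity
  nlinarith [mul_nonneg hc (sq_nonneg (((p.2 : ℝ) + s) + ((p.1 : ℝ) + s)))]

/-- The series `a(q)` converges absolutely in the upper half-plane. -/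
theorem hasSum_cubicA {τ : ℂ} (hτ : 0 < τ.im) :
    HasSum (fun p : ℤ × ℤ => qPow τ ((p.2 : ℝ) ^ 2 + p.2 * p.1 + (p.1 : ℝ) ^ 2))
      (cubicA τ) := by
  have h := summable_shifted hτ 0
  simp only [add_zero] at h
  exact h.hasSum

/-- The series `c(q)` converges absolutely in the upper half-plane. -/
theorem hasSum_cubicC {τ : ℂ} (hτ : 0 < τ.im) :
    HasSum (fun p : ℤ × ℤ => qPow τ
      (((p.2 : ℝ) + 1 / 3) ^ 2 + ((p.2 : ℝ) + 1 / 3) * ((p.1 : ℝ) + 1 / 3)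
        + ((p.1 : ℝ) + 1 / 3) ^ 2)) (cubicC τ) :=
  (summable_shifted hτ (1 / 3)).hasSum

end CubicTheta

end

namespace CubicTheta

/-! Both sides are the theta series of the lattice `D₄`. Averaging `θ₃⁴` and `θ₄⁴` keeps the vectors
of `ℤ⁴` with even coordinate sum. On the other side, `D₄` contains `A₂ ⊕ A₂(2)` with index 3; the
trivial coset gives `a(q)a(q²)` and the other two give `c(q)c(q²)` each (`hasSum_glueClass_zero`,
`hasSum_glueClass_one`, `hasSum_glueClass_neg_one`). -/

theorem qPow_add (τ : ℂ) (r s : ℝ) : qPow τ (r + s) = qPow τ r * qPow τ s := by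
  rw [qPow, qPow, qPow, ← Complex.exp_add]
  congr 1
  push_cast
  ring

theorem qPow_mul (τ : ℂ) (k r : ℝ) : qPow (k * τ) r = qPow τ (k * r) := by
  rw [qPow, qPow]
  congr 1
  push_cast
  ring

theorem hasSum_mul_complex {α β : Type*} {f : α → ℂ} {g : β → ℂ} {a b : ℂ}
    (hf : HasSum f a) (hg : HasSum g b) :
    HasSum (fun p : α × β => f p.1 * g p.2) (a * b) :=
  hf.mul hg (summable_mul_of_summable_norm hf.summable.norm hg.summable.norm)

/-- The series `c(q)` with the opposite shift. -/
theorem hasSum_cubicC_neg {τ : ℂ} (hτ : 0 < τ.im) :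
    HasSum (fun p : ℤ × ℤ => qPow τ
      (((p.2 : ℝ) - 1 / 3) ^ 2 + ((p.2 : ℝ) - 1 / 3) * ((p.1 : ℝ) - 1 / 3)
        + ((p.1 : ℝ) - 1 / 3) ^ 2)) (cubicC τ) := by
  have h := (Equiv.neg (ℤ × ℤ)).hasSum_iff.mpr (hasSum_cubicC hτ)
  convert h using 2 with p
  simp only [Function.comp_apply, Equiv.neg_apply, Prod.fst_neg, Prod.snd_neg, Int.cast_neg]
  congr 1
  ring

/-- Half the squared norm of a vector of `ℤ ^ 4`. -/
noncomputable def halfNormSq (x : (ℤ × ℤ) × (ℤ × ℤ)) : ℝ :=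
  ((x.1.1 : ℝ) ^ 2 + (x.1.2 : ℝ) ^ 2 + (x.2.1 : ℝ) ^ 2 + (x.2.2 : ℝ) ^ 2) / 2

/-- The vectors of the lattice `D₄` whose first three coordinates add up to `r` modulo `3`. -/
def glueClass (r : ℤ) : Set ((ℤ × ℤ) × (ℤ × ℤ)) :=
  {x | 2 ∣ x.1.1 + x.1.2 + x.2.1 + x.2.2 ∧ 3 ∣ x.1.1 + x.1.2 + x.2.1 - r}

/-- A parametrization of `glueClass r` by a coset of `A₂ ⊕ A₂(2)`. -/
def glueMap (r : ℤ) (p : (ℤ × ℤ) × (ℤ × ℤ)) : (ℤ × ℤ) × (ℤ × ℤ) :=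
  ((p.1.1 + p.2.1, p.1.2 + p.2.1), (p.2.1 - p.1.1 - p.1.2 + r, p.2.1 + 2 * p.2.2 + r))

theorem glueMap_injective (r : ℤ) : Function.Injective (glueMap r) := by
  rintro ⟨⟨m, n⟩, ⟨a, l⟩⟩ ⟨⟨m', n'⟩, ⟨a', l'⟩⟩ h
  simp only [glueMap, Prod.mk.injEq] at h ⊢
  omega

theorem range_glueMap (r : ℤ) : Set.range (glueMap r) = glueClass r := by
  ext ⟨⟨x, y⟩, ⟨z, w⟩⟩
  simp only [Set.mem_range, glueClass, glueMap, Set.mem_ofPred_eq]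
  constructor
  · rintro ⟨⟨⟨m, n⟩, ⟨a, l⟩⟩, h⟩
    simp only [Prod.mk.injEq] at h
    omega
  · rintro ⟨⟨k, hk⟩, ⟨a, ha⟩⟩
    -- The last entry solves `w = a + 2l + r`, using `w = 2k - (3a + r)`.
    refine ⟨((x - a, y - a), (a, k - 2 * a - r)), ?_⟩
    simp only [Prod.mk.injEq]
    omega

/-- Extension by zero to `ℤ⁴` lets the three cosets be added termwise. -/
theorem hasSum_glueClass {τ : ℂ} {r : ℤ} {S : ℂ}
    (h : HasSum (fun p => qPow τ (halfNormSq (glueMap r p))) S) :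
    HasSum ((glueClass r).indicator fun x => qPow τ (halfNormSq x)) S := by
  refine ((glueMap_injective r).hasSum_iff fun x hx => ?_).mp ?_
  · rw [range_glueMap] at hx
    exact Set.indicator_of_notMem hx _
  · convert h using 2 with p
    exact Set.indicator_of_mem (range_glueMap r ▸ Set.mem_range_self p) _

/-- The vectors `(m, n, -m-n, 0)` and `(a, a, a, a+2l)` are orthogonal, with half norms `m² + mn +
n²` and `2(a² + al + l²)`. -/
theorem hasSum_glueClass_zero {τ : ℂ} (hτ : 0 < τ.im) :
    HasSum ((glueClass 0).indicator fun x => qPow τ (halfNormSq x))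
      (cubicA τ * cubicA (2 * τ)) := by
  have h2 : 0 < (2 * τ).im := by simpa using hτ
  refine hasSum_glueClass ?_
  convert hasSum_mul_complex (hasSum_cubicA hτ) (hasSum_cubicA h2) using 2 with p
  rw [show (2 : ℂ) = ((2 : ℝ) : ℂ) by norm_num, qPow_mul, ← qPow_add]
  congr 1
  simp only [halfNormSq, glueMap]
  push_cast
  ring

theorem hasSum_glueClass_one {τ : ℂ} (hτ : 0 < τ.im) :
    HasSum ((glueClass 1).indicator fun x => qPow τ (halfNormSq x))
      (cubicC τ * cubicC (2 * τ)) := by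
  have h2 : 0 < (2 * τ).im := by simpa using hτ
  refine hasSum_glueClass ?_
  -- Moving `(1/3, 1/3, 1/3)` from the `A₂` part to the `A₂(2)` part restores orthogonality, so the
  -- two shifts have opposite signs.
  convert hasSum_mul_complex (hasSum_cubicC_neg hτ) (hasSum_cubicC h2) using 2 with p
  rw [show (2 : ℂ) = ((2 : ℝ) : ℂ) by norm_num, qPow_mul, ← qPow_add]
  congr 1
  simp only [halfNormSq, glueMap]
  push_cast
  ring

theorem hasSum_glueClass_neg_one {τ : ℂ} (hτ : 0 < τ.im) :
    HasSum ((glueClass (-1)).indicator fun x => qPow τ (halfNormSq x))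
      (cubicC τ * cubicC (2 * τ)) := by
  have h2 : 0 < (2 * τ).im := by simpa using hτ
  refine hasSum_glueClass ?_
  convert hasSum_mul_complex (hasSum_cubicC hτ) (hasSum_cubicC_neg h2) using 2 with p
  rw [show (2 : ℂ) = ((2 : ℝ) : ℂ) by norm_num, qPow_mul, ← qPow_add]
  congr 1
  simp only [halfNormSq, glueMap]
  push_cast
  ring

theorem qPow_halfNormSq (τ : ℂ) (x : (ℤ × ℤ) × (ℤ × ℤ)) :
    qPow τ (halfNormSq x) =
      qPow (τ / 2) ((x.1.1 : ℝ) ^ 2) * qPow (τ / 2) ((x.1.2 : ℝ) ^ 2) *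
        (qPow (τ / 2) ((x.2.1 : ℝ) ^ 2) * qPow (τ / 2) ((x.2.2 : ℝ) ^ 2)) := by
  rw [show τ / 2 = ((1 / 2 : ℝ) : ℂ) * τ by push_cast; ring]
  simp only [qPow_mul, ← qPow_add]
  congr 1
  rw [halfNormSq]
  ring

theorem hasSum_theta3_pow_four {τ : ℂ} (hτ : 0 < τ.im) :
    HasSum (fun x => qPow τ (halfNormSq x)) (theta3 (τ / 2) ^ 4) := by
  have h : HasSum _ (theta3 (τ / 2)) := hasSum_theta3 (τ := τ / 2) (by simpa using hτ)
  have h2 := hasSum_mul_complex h h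
  convert hasSum_mul_complex h2 h2 using 1
  · exact funext fun x => qPow_halfNormSq τ x
  · ring

theorem hasSum_theta4_pow_four {τ : ℂ} (hτ : 0 < τ.im) :
    HasSum (fun x : (ℤ × ℤ) × (ℤ × ℤ) =>
      (-1 : ℂ) ^ (x.1.1 + x.1.2 + x.2.1 + x.2.2) * qPow τ (halfNormSq x))
      (theta4 (τ / 2) ^ 4) := by
  have h : HasSum _ (theta4 (τ / 2)) := hasSum_theta4 (τ := τ / 2) (by simpa using hτ)
  have h2 := hasSum_mul_complex h h
  convert hasSum_mul_complex h2 h2 using 1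
  · funext x
    have h0 : (-1 : ℂ) ≠ 0 := by norm_num
    rw [qPow_halfNormSq, zpow_add₀ h0, zpow_add₀ h0, zpow_add₀ h0]
    ring
  · ring

/-- The residues `0, 1, -1` modulo 3 partition `D₄`, and `(1 + (-1)^s)/2` detects even `s`. -/
theorem sum_indicator_glueClass (f : (ℤ × ℤ) × (ℤ × ℤ) → ℂ) (x : (ℤ × ℤ) × (ℤ × ℤ)) :
    (glueClass 0).indicator f x
        + ((glueClass 1).indicator f x + (glueClass (-1)).indicator f x)
      = 1 / 2 * (f x + (-1 : ℂ) ^ (x.1.1 + x.1.2 + x.2.1 + x.2.2) * f x) := by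
  classical
  simp only [Set.indicator_apply, glueClass, Set.mem_ofPred_eq]
  rcases Int.even_or_odd (x.1.1 + x.1.2 + x.2.1 + x.2.2) with h | h
  · have h2 : 2 ∣ x.1.1 + x.1.2 + x.2.1 + x.2.2 := h.two_dvd
    rw [h.neg_one_zpow]
    have h3 : (x.1.1 + x.1.2 + x.2.1) % 3 = 0 ∨ (x.1.1 + x.1.2 + x.2.1) % 3 = 1 ∨
        (x.1.1 + x.1.2 + x.2.1) % 3 = 2 := by omega
    rcases h3 with h3 | h3 | h3
    · rw [if_pos (by omega), if_neg (by omega), if_neg (by omega)]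
      ring
    · rw [if_neg (by omega), if_pos (by omega), if_neg (by omega)]
      ring
    · rw [if_neg (by omega), if_neg (by omega), if_pos (by omega)]
      ring
  · have h2 : ¬ 2 ∣ x.1.1 + x.1.2 + x.2.1 + x.2.2 :=
      fun h' => (Int.not_even_iff_odd.mpr h)
        (even_iff_two_dvd.mpr h')
    rw [h.neg_one_zpow]
    simp [h2]

end CubicTheta

theorem mainTheorem8 (τ : ℂ) (hτ : 0 < τ.im) :
    CubicTheta.cubicA τ * CubicTheta.cubicA (2 * τ)
        + 2 * (CubicTheta.cubicC τ * CubicTheta.cubicC (2 * τ))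
      = 1 / 2 * (CubicTheta.theta3 (τ / 2) ^ 4 + CubicTheta.theta4 (τ / 2) ^ 4) := by
  have hl := (CubicTheta.hasSum_glueClass_zero hτ).add
    ((CubicTheta.hasSum_glueClass_one hτ).add (CubicTheta.hasSum_glueClass_neg_one hτ))
  have hr := ((CubicTheta.hasSum_theta3_pow_four hτ).add
    (CubicTheta.hasSum_theta4_pow_four hτ)).mul_left (1 / 2)
  rw [two_mul (CubicTheta.cubicC τ * _)]
  simp only [CubicTheta.sum_indicator_glueClass] at hl
  exact hl.unique hr
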